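/- Let $k\ge 1$ be a fixed integer. For a word $x=x_1x_2\cdots x_n\in[k]^n$ over the alphabet $[k]=\{1,\dots,k\}$, the horizontal visibility graph $\mathrm{HVG}(x)$ is the graph with vertex set $\{1,\dots,n\}$ in which $i<j$ are adjacent if and only if $x_l<\min(x_i,x_j)$ for every $l$ with $i<l<j$. Then the average number of edges of $\mathrm{HVG}(x)$ over all $k^n$ words $x\in[k]^n$ satisfies $$\frac1{k^n}\sum_{x\in[k]^n}\bigl|E(\mathrm{HVG}(x))\bigr|\;\sim\;\left(2-\frac{\Psi(k+1)+\gamma}{k}\right)n\qquad(n\to\infty),$$ where $\Psi=\Gamma'/\Gamma$ is the digamma function, $\gamma$ is Euler's constant, and $a_n\sim b_n$ means $a_n/b_n\to1$. -/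

import Mathlib

open Filter Asymptotics

/-- The horizontal visibility graph of a finite sequence `x` (for instance of non-negative reals):
the vertices are the positions, and two positions are adjacent if every entry strictly between
them is smaller than both of their entries. -/
def hvg {α : Type*} [LinearOrder α] {n : ℕ} (x : Fin n → α) : SimpleGraph (Fin n) where
  Adj i j := i ≠ j ∧ ∀ l, min i j < l → l < max i j → x l < x i ∧ x l < x j
  symm := ⟨fun i j h => ⟨h.1.symm, fun l h₁ h₂ =>
    (h.2 l (by rwa [min_comm]) (by rwa [max_comm])).symm⟩⟩
  loopless := ⟨fun _ h => h.1 rfl⟩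

instance {α : Type*} [LinearOrder α] {n : ℕ} (x : Fin n → α) : DecidableRel (hvg x).Adj :=
  fun i j => inferInstanceAs
    (Decidable (i ≠ j ∧ ∀ l, min i j < l → l < max i j → x l < x i ∧ x l < x j))

/-- The words of length `n` over the alphabet `{1, …, k}`. -/
abbrev Word (k n : ℕ) : Type := Fin n → Finset.Icc 1 k

/-- The average number of edges of the horizontal visibility graph of a word,
over all words of length `n` over the alphabet `{1, …, k}`. -/
noncomputable def avgHVGEdges (k n : ℕ) : ℝ :=
  (∑ x : Word k n, ((hvg x).edgeFinset.card : ℝ)) / (Fintype.card (Word k n) : ℝ)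

/-! By linearity of expectation, the average is the sum over `i < j` of the probability of
adjacency, which depends only on the gap `m = j - i - 1`. With letters shifted to `0, …, k - 1`, end
letters `a`, `b` have exactly `min a b` letters below both, so this probability is the mean of `(min
a b / k) ^ m` (`card_word_hvg_adj`). Summing the geometric series over `m` gives `2 - harmonic k /
k` (`hasSum_visibilityProb`). The average is a sum of `n` partial sums of this series
(`avgHVGEdges_eq`), so Cesàro convergence gives the asymptotics, and `Ψ(k+1) + γ` is `harmonic k`.
-/

lemma digamma_natCast_add_one (k : ℕ) :
    Complex.digamma ((k : ℂ) + 1) = (harmonic k : ℂ) - Real.eulerMascheroniConstant := by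
  induction k with
  | zero => simp [Complex.digamma_one]
  | succ k ih =>
    rw [Complex.digamma_apply_add_one, Nat.cast_add_one, ih, harmonic_succ]
    · push_cast
      ring
    -- The recurrence for `digamma` needs `k + 1` not to be a pole, i.e. not a nonpositive integer.
    · intro m h
      have h' : (((k + 1 + m : ℕ)) : ℂ) = 0 := by
        push_cast at h ⊢
        rw [h]
        ring
      norm_cast at h'
      omega

/-- In passing to `k + 1`, the row and column of index `0` contribute `2k + 1` terms `1 / (k + 1)`,
that is `2 - 1 / (k + 1)`; shifting both remaining indices by one leaves the sum for `k`. -/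
lemma sum_inv_sub_min (k : ℕ) :
    ∑ a ∈ Finset.range k, ∑ b ∈ Finset.range k, ((k : ℝ) - (min a b : ℕ))⁻¹ =
      2 * k - harmonic k := by
  induction k with
  | zero => simp
  | succ k ih =>
    simp only [Finset.sum_range_succ' _ k, Finset.sum_add_distrib, Nat.zero_min, Nat.min_zero,
      Nat.succ_min_succ, harmonic_succ]
    have h (c : ℕ) : ((k + 1 : ℕ) : ℝ) - ((c + 1 : ℕ) : ℝ) = k - c := by
      push_cast
      ring
    simp only [h, ih, Finset.sum_const, Finset.card_range, nsmul_eq_mul]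
    have hk : (k : ℝ) + 1 ≠ 0 := by positivity
    push_cast
    field_simp
    ring

/-- The probability that two positions with `m` positions in between are adjacent in the
horizontal visibility graph of a uniformly random word over an alphabet of `k` letters. -/
noncomputable def visibilityProb (k m : ℕ) : ℝ :=
  (∑ a ∈ Finset.range k, ∑ b ∈ Finset.range k, (((min a b : ℕ) : ℝ) / k) ^ m) / k ^ 2

lemma hasSum_visibilityProb {k : ℕ} (hk : 1 ≤ k) :
    HasSum (visibilityProb k) (2 - harmonic k / k) := by
  have hk0 : (0 : ℝ) < k := by exact_mod_cast hk
  have h : HasSum (visibilityProb k)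
      ((∑ a ∈ Finset.range k, ∑ b ∈ Finset.range k,
        (1 - ((min a b : ℕ) : ℝ) / k)⁻¹) / k ^ 2) := by
    refine HasSum.div_const (hasSum_sum fun a ha => hasSum_sum fun b _ => ?_) _
    refine hasSum_geometric_of_lt_one (by positivity) ?_
    rw [div_lt_one hk0]
    exact_mod_cast (min_le_left a b).trans_lt (Finset.mem_range.1 ha)
  convert h using 1
  have h1 (c : ℕ) : (1 - (c : ℝ) / k)⁻¹ = k * ((k : ℝ) - c)⁻¹ := by
    rw [one_sub_div hk0.ne', inv_div, div_eq_mul_inv]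
  simp only [h1, ← Finset.mul_sum, sum_inv_sub_min]
  field_simp

lemma card_edgeFinset_eq_sum_lt {n : ℕ} (G : SimpleGraph (Fin n)) [DecidableRel G.Adj] :
    G.edgeFinset.card = ∑ j, ∑ i ∈ Finset.Iio j, if G.Adj i j then 1 else 0 := by
  have h : G.edgeFinset = (((Finset.univ : Finset (Fin n)).sigma fun j =>
      (Finset.Iio j).filter fun i => G.Adj i j).image fun p => s(p.2, p.1)) := by
    ext e
    induction e using Sym2.ind with | _ a b => ?_
    simp only [SimpleGraph.mem_edgeFinset, SimpleGraph.mem_edgeSet, Finset.mem_image,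
      Finset.mem_sigma, Finset.mem_univ, Finset.mem_filter, Finset.mem_Iio, true_and, Sigma.exists]
    constructor
    · intro hab
      rcases lt_or_gt_of_ne hab.ne with hlt | hlt
      · exact ⟨b, a, ⟨hlt, hab⟩, rfl⟩
      · exact ⟨a, b, ⟨hlt, hab.symm⟩, Sym2.eq_swap⟩
    · rintro ⟨j, i, ⟨-, hij⟩, he⟩
      rwa [← SimpleGraph.mem_edgeSet, ← he]
  rw [h, Finset.card_image_of_injOn, Finset.card_sigma]
  · simp only [Finset.card_filter]
  · rintro ⟨j, i⟩ hp ⟨j', i'⟩ hp' he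
    simp only [Finset.coe_sigma, Set.mem_sigma_iff, Finset.mem_coe, Finset.mem_filter,
      Finset.mem_Iio] at hp hp'
    rcases Sym2.eq_iff.1 he with ⟨h1, h2⟩ | ⟨h1, h2⟩
    · simp_all
    · dsimp only at h1 h2
      subst h1 h2
      exact absurd hp.2.1 hp'.2.1.asymm

lemma hvg_adj_iff_of_lt {α : Type*} [LinearOrder α] {n : ℕ} (x : Fin n → α) {i j : Fin n}
    (hij : i < j) : (hvg x).Adj i j ↔ ∀ l ∈ Finset.Ioo i j, x l < min (x i) (x j) := by
  simp only [hvg, ne_eq, hij.ne, not_false_eq_true, true_and, min_eq_left hij.le,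
    max_eq_right hij.le, Finset.mem_Ioo, lt_min_iff, and_imp]

/-- Once the letters at `i` and `j` are fixed, adjacency constrains each position separately, so the
words in question form a product set `Fintype.piFinset (t a b)`. -/
lemma card_hvg_adj {α : Type*} [LinearOrder α] [Fintype α] {n : ℕ} {i j : Fin n} (hij : i < j) :
    (((Finset.univ : Finset (Fin n → α)).filter fun x => (hvg x).Adj i j).card : ℝ) /
        (Fintype.card (Fin n → α) : ℝ) =
      (∑ a : α, ∑ b : α, (((Finset.univ.filter (· < min a b)).card : ℝ) / Fintype.card α) ^
        ((j : ℕ) - i - 1)) / (Fintype.card α : ℝ) ^ 2 := by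
  rcases isEmpty_or_nonempty α with hα | hα
  · have : IsEmpty (Fin n → α) := ⟨fun x => hα.false (x i)⟩
    simp
  have hc : (Fintype.card α : ℝ) ≠ 0 := by exact_mod_cast Fintype.card_ne_zero
  let t (a b : α) (l : Fin n) : Finset α :=
    if l = i then {a} else if l = j then {b} else
      if l ∈ Finset.Ioo i j then Finset.univ.filter (· < min a b) else Finset.univ
  have hfib (a b : α) : ((Finset.univ : Finset (Fin n → α)).filter fun x => (hvg x).Adj i j).filter
      (fun x => (x i, x j) = (a, b)) = Fintype.piFinset (t a b) := by
    ext x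
    simp only [Finset.mem_filter, Finset.mem_univ, true_and, hvg_adj_iff_of_lt x hij,
      Fintype.mem_piFinset, Prod.mk.injEq, t]
    constructor
    · rintro ⟨h, rfl, rfl⟩ l
      split_ifs with h1 h2 h3
      · simp [h1]
      · simp [h2]
      · simpa using h l h3
      · simp
    · intro h
      have hi : x i = a := by simpa using h i
      have hj : x j = b := by simpa [hij.ne'] using h j
      refine ⟨fun l hl => ?_, hi, hj⟩
      have hl' := Finset.mem_Ioo.1 hl
      have := h l
      rw [if_neg hl'.1.ne', if_neg hl'.2.ne, if_pos hl] at this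
      rw [hi, hj]
      simpa using this
  have hcard (a b : α) : ((Fintype.piFinset (t a b)).card : ℝ) / (Fintype.card (Fin n → α) : ℝ) =
      (((Finset.univ.filter (· < min a b)).card : ℝ) / Fintype.card α) ^ ((j : ℕ) - i - 1) /
        (Fintype.card α : ℝ) ^ 2 := by
    -- Written as three independent factors, so that the product over `l` splits into the two end
    -- positions and a power over `Ioo i j`.
    have hf : ∀ l, ((t a b l).card : ℝ) / Fintype.card α =
        (if l = i then (Fintype.card α : ℝ)⁻¹ else 1) *
        (if l = j then (Fintype.card α : ℝ)⁻¹ else 1) *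
        (if l ∈ Finset.Ioo i j then
          ((Finset.univ.filter (· < min a b)).card : ℝ) / Fintype.card α else 1) := by
      intro l
      by_cases h1 : l = i
      · subst h1
        simp [t, hij.ne]
      by_cases h2 : l = j
      · subst h2
        simp [t, hij.ne']
      by_cases h3 : l ∈ Finset.Ioo i j
      · simp only [t, if_neg h1, if_neg h2, if_pos h3, one_mul]
      · simp only [t, if_neg h1, if_neg h2, if_neg h3, one_mul, Finset.card_univ, div_self hc]
    have hp : (Fintype.card (Fin n → α) : ℝ) = ∏ _l : Fin n, (Fintype.card α : ℝ) := by simp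
    rw [Fintype.card_piFinset, Nat.cast_prod, hp, ← Finset.prod_div_distrib]
    simp only [hf, Finset.prod_mul_distrib, Finset.prod_ite_eq', Finset.mem_univ, if_true]
    rw [Finset.prod_ite_mem, Finset.univ_inter, Finset.prod_const, Fin.card_Ioo]
    field_simp
  rw [Finset.card_eq_sum_card_fiberwise (f := fun x => (x i, x j)) (t := Finset.univ)
    (fun _ _ => Finset.mem_coe.2 (Finset.mem_univ _)), Fintype.sum_prod_type]
  push_cast
  simp only [hfib, Finset.sum_div, hcard]

lemma sum_letter_eq_sum_range {k : ℕ} (f : ℕ → ℝ) :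
    ∑ a : Finset.Icc 1 k, f ((a : ℕ) - 1) = ∑ a ∈ Finset.range k, f a := by
  rw [Finset.sum_coe_sort (Finset.Icc 1 k) fun a => f (a - 1), Finset.range_eq_Ico,
    Finset.sum_Ico_add_right_sub_eq (f := f) (c := 1) 0 k |>.symm]
  rfl

lemma card_letter_lt {k : ℕ} (c : Finset.Icc 1 k) :
    ((Finset.univ : Finset (Finset.Icc 1 k)).filter (· < c)).card = (c : ℕ) - 1 := by
  have h : (((Finset.univ : Finset (Finset.Icc 1 k)).filter (· < c)).map
      (Function.Embedding.subtype _)) = Finset.Ico 1 (c : ℕ) := by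
    ext a
    have := (Finset.mem_Icc.1 c.2).2
    simp only [Finset.mem_map, Finset.mem_filter, Finset.mem_univ, true_and,
      Function.Embedding.subtype_apply, Finset.mem_Ico]
    constructor
    · rintro ⟨b, hb, rfl⟩
      exact ⟨(Finset.mem_Icc.1 b.2).1, hb⟩
    · rintro ⟨h1, h2⟩
      exact ⟨⟨a, Finset.mem_Icc.2 ⟨h1, by omega⟩⟩, h2, rfl⟩
  rw [← Finset.card_map, h, Nat.card_Ico]

lemma card_word_hvg_adj {k n : ℕ} {i j : Fin n} (hij : i < j) :
    (((Finset.univ : Finset (Word k n)).filter fun x => (hvg x).Adj i j).card : ℝ) /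
        (Fintype.card (Word k n) : ℝ) = visibilityProb k ((j : ℕ) - i - 1) := by
  have hmin (a b : Finset.Icc 1 k) :
      ((min a b : Finset.Icc 1 k) : ℕ) - 1 = min ((a : ℕ) - 1) ((b : ℕ) - 1) := by
    rw [show ((min a b : Finset.Icc 1 k) : ℕ) = min (a : ℕ) b from
      (Subtype.mono_coe _).map_min]
    omega
  rw [card_hvg_adj hij, visibilityProb]
  simp only [card_letter_lt, hmin, Fintype.card_coe, Nat.card_Icc, Nat.add_sub_cancel]
  rw [← sum_letter_eq_sum_range]
  simp only [← sum_letter_eq_sum_range (k := k)]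

lemma avgHVGEdges_eq (k n : ℕ) :
    avgHVGEdges k n = ∑ j ∈ Finset.range n, ∑ m ∈ Finset.range j, visibilityProb k m := by
  have h : avgHVGEdges k n = ∑ j : Fin n, ∑ i ∈ Finset.Iio j,
      (((Finset.univ : Finset (Word k n)).filter fun x => (hvg x).Adj i j).card : ℝ) /
        (Fintype.card (Word k n) : ℝ) := by
    simp only [avgHVGEdges, card_edgeFinset_eq_sum_lt, ← Finset.sum_div]
    push_cast
    rw [Finset.sum_comm]
    congr 1
    refine Finset.sum_congr rfl fun j _ => ?_
    rw [Finset.sum_comm]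
    simp
  rw [h, ← Fin.sum_univ_eq_sum_range (fun j => ∑ m ∈ Finset.range j, visibilityProb k m)]
  refine Finset.sum_congr rfl fun j _ => ?_
  -- For fixed `j`, the gap `j - i - 1` runs through `range j` in reverse order as `i` increases.
  rw [Finset.sum_congr rfl fun i hi => card_word_hvg_adj (Finset.mem_Iio.1 hi),
    ← Finset.sum_range_reflect]
  refine (Finset.sum_map _ Fin.valEmbedding
    fun i => visibilityProb k ((j : ℕ) - i - 1)).symm.trans ?_
  rw [Fin.map_valEmbedding_Iio, Nat.Iio_eq_range]
  exact Finset.sum_congr rfl fun i _ => by rw [Nat.sub_right_comm]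

theorem mainTheorem6 (k : ℕ) (hk : 1 ≤ k) :
    (fun n : ℕ => avgHVGEdges k n) ~[atTop]
      (fun n : ℕ =>
        (2 - ((Complex.digamma ((k : ℂ) + 1)).re + Real.eulerMascheroniConstant) / (k : ℝ))
          * (n : ℝ)) := by
  have hre : (Complex.digamma ((k : ℂ) + 1)).re + Real.eulerMascheroniConstant = harmonic k := by
    rw [digamma_natCast_add_one]
    simp
  rw [hre]
  -- Equivalence is tested through the quotient, so the constant must be nonzero; `harmonic k ≤ k`
  -- makes it at least `1`.
  have hpos : (0 : ℝ) < 2 - harmonic k / k := by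
    have hk0 : (0 : ℝ) < k := by exact_mod_cast hk
    have hle : (harmonic k : ℝ) ≤ k := by
      rw [harmonic]
      push_cast
      refine (Finset.sum_le_card_nsmul _ _ 1 fun i _ => ?_).trans (by simp)
      exact inv_le_one_of_one_le₀ (by linarith [(Nat.cast_nonneg i : (0 : ℝ) ≤ i)])
    have := (div_le_one hk0).2 hle
    linarith
  have hlim := (hasSum_visibilityProb hk).tendsto_sum_nat.cesaro
  refine (isEquivalent_iff_tendsto_one ?_).2 ?_
  · filter_upwards [eventually_gt_atTop 0] with n hn
    exact mul_ne_zero hpos.ne' (by exact_mod_cast hn.ne')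
  · have h := hlim.div_const (2 - (harmonic k : ℝ) / k)
    rw [div_self hpos.ne'] at h
    refine h.congr fun n => ?_
    rw [Pi.div_apply, avgHVGEdges_eq, inv_mul_eq_div, div_div, mul_comm (n : ℝ)]
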